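/- Let $(\Omega,\Sigma,\mu)$ be a $\sigma$-finite measure space. A Köthe function space over it is a Banach space $E$ of (equivalence classes modulo $\mu$-a.e. equality of) measurable real-valued functions on $\Omega$ such that (1) $\chi_A\in E$ for every $A\in\Sigma$ with $\mu(A)<\infty$, and (2) if $f$ is measurable, $g\in E$ and $|f|\le|g|$ a.e., then $f\in E$ and $\|f\|_E\le\|g\|_E$. It is order continuous if $\|f_n\|_E\to0$ for every decreasing sequence $(f_n)$ in $E$ with $f_n\to0$ a.e. For a real normed space $X$, the Köthe–Bochner space $E(X)$ is the space of (classes of) strongly measurable functions $F:\Omega\to X$ such that $\omega\mapsto\|F(\omega)\|_X$ belongs to $E$, with the norm $\|F\|_{E(X)}=\big\|\,\|F(\cdot)\|_X\,\big\|_E$; for a subspace $Y\subseteq X$, $E(Y)$ is regarded as a subspace of $E(X)$. A closed linear subspace $Y$ of $X$ is called a central subspace of $X$ if every finite family of closed balls (of positive radii) in $X$ with centers in $Y$ whose intersection is nonempty has a common point that lies in $Y$. Theorem 2.9. Let $E$ be an order continuous Köthe function space over a $\sigma$-finite measure space, let $X$ be a real Banach space and let $Y$ be a separable central subspace of $X$.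 Then $E(Y)$ is a central subspace of $E(X)$ (in particular it is closed in $E(X)$). -/

import Mathlib

open MeasureTheory Filter Topology

/-- A Köthe function space over the measure space `(Ω, Σ, μ)`: a Banach space of (classes modulo
`μ`-a.e. equality of) measurable real functions which contains the indicator functions of the
measurable sets of finite measure and is solid (an order ideal with a monotone norm). -/
structure KotheFunctionSpace {Ω : Type*} [MeasurableSpace Ω] (μ : Measure Ω) where
  /-- The underlying vector space of functions. -/
  toSubmodule : Submodule ℝ (Ω →ₘ[μ] ℝ)
  /-- The norm of the space. -/
  norm : toSubmodule → ℝ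
  norm_nonneg : ∀ f, 0 ≤ norm f
  norm_smul : ∀ (c : ℝ) f, norm (c • f) = |c| * norm f
  norm_add_le : ∀ f g, norm (f + g) ≤ norm f + norm g
  eq_zero_of_norm_eq_zero : ∀ f, norm f = 0 → f = 0
  complete : ∀ u : ℕ → toSubmodule,
    (∀ ε > 0, ∃ N, ∀ m ≥ N, ∀ n ≥ N, norm (u m - u n) < ε) →
      ∃ f, Tendsto (fun n => norm (u n - f)) atTop (𝓝 0)
  indicator_mem : ∀ (A : Set Ω) (hA : MeasurableSet A), μ A < ⊤ →
    AEEqFun.mk (A.indicator fun _ => (1 : ℝ)) (aestronglyMeasurable_const.indicator hA)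
      ∈ toSubmodule
  mem_of_abs_le : ∀ f g : Ω →ₘ[μ] ℝ, g ∈ toSubmodule → (∀ᵐ ω ∂μ, |f ω| ≤ |g ω|) →
    f ∈ toSubmodule
  norm_le_of_abs_le : ∀ f g : toSubmodule,
    (∀ᵐ ω ∂μ, |(f : Ω →ₘ[μ] ℝ) ω| ≤ |(g : Ω →ₘ[μ] ℝ) ω|) → norm f ≤ norm g

/-- Order continuity: a decreasing sequence in `E` that tends to `0` almost everywhere
tends to `0` in norm. -/
def KotheFunctionSpace.IsOrderContinuous {Ω : Type*} [MeasurableSpace Ω] {μ : Measure Ω}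
    (E : KotheFunctionSpace μ) : Prop :=
  ∀ f : ℕ → E.toSubmodule,
    (∀ m n, m ≤ n → ∀ᵐ ω ∂μ, (f n : Ω →ₘ[μ] ℝ) ω ≤ (f m : Ω →ₘ[μ] ℝ) ω) →
    (∀ᵐ ω ∂μ, Tendsto (fun n => (f n : Ω →ₘ[μ] ℝ) ω) atTop (𝓝 0)) →
    Tendsto (fun n => E.norm (f n)) atTop (𝓝 0)

/-- The class of `ω ↦ ‖F ω‖`. -/
noncomputable def aeNorm {Ω : Type*} [MeasurableSpace Ω] {μ : Measure Ω} {X : Type*}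
    [NormedAddCommGroup X] (F : Ω →ₘ[μ] X) : Ω →ₘ[μ] ℝ :=
  AEEqFun.comp (fun x : X => ‖x‖) continuous_norm F

theorem coeFn_aeNorm {Ω : Type*} [MeasurableSpace Ω] {μ : Measure Ω} {X : Type*}
    [NormedAddCommGroup X] (F : Ω →ₘ[μ] X) : ∀ᵐ ω ∂μ, aeNorm F ω = ‖F ω‖ :=
  AEEqFun.coeFn_comp _ continuous_norm F

/-- The vector space underlying the Köthe-Bochner space `E(X)`: the classes of strongly measurable
`F : Ω → X` with `‖F(·)‖ ∈ E`. -/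
def KotheFunctionSpace.bochnerSubmodule {Ω : Type*} [MeasurableSpace Ω] {μ : Measure Ω}
    (E : KotheFunctionSpace μ) (X : Type*) [NormedAddCommGroup X] [NormedSpace ℝ X] :
    Submodule ℝ (Ω →ₘ[μ] X) where
  carrier := {F | aeNorm F ∈ E.toSubmodule}
  zero_mem' := by
    refine E.mem_of_abs_le _ 0 E.toSubmodule.zero_mem ?_
    filter_upwards [coeFn_aeNorm (0 : Ω →ₘ[μ] X), AEEqFun.coeFn_zero (α := Ω) (μ := μ) (β := X)]
      with ω h1 h2
    simp [h1, h2]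
  add_mem' := by
    intro F G hF hG
    refine E.mem_of_abs_le _ (aeNorm F + aeNorm G) (E.toSubmodule.add_mem hF hG) ?_
    filter_upwards [coeFn_aeNorm (F + G), coeFn_aeNorm F, coeFn_aeNorm G, AEEqFun.coeFn_add F G,
      AEEqFun.coeFn_add (aeNorm F) (aeNorm G)] with ω h1 h2 h3 h4 h5
    rw [h1, h4, h5, Pi.add_apply, Pi.add_apply, h2, h3, abs_of_nonneg (by positivity),
      abs_of_nonneg (by positivity)]
    exact _root_.norm_add_le _ _
  smul_mem' := by
    intro c F hF
    refine E.mem_of_abs_le _ (c • aeNorm F) (E.toSubmodule.smul_mem c hF) ?_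
    filter_upwards [coeFn_aeNorm (c • F), coeFn_aeNorm F, AEEqFun.coeFn_smul c F,
      AEEqFun.coeFn_smul c (aeNorm F)] with ω h1 h2 h3 h4
    rw [h1, h3, h4, Pi.smul_apply, Pi.smul_apply, h2, _root_.norm_smul]
    simp [abs_mul]

/-- The Köthe-Bochner space `E(X)`. -/
def KotheBochner {Ω : Type*} [MeasurableSpace Ω] {μ : Measure Ω}
    (E : KotheFunctionSpace μ) (X : Type*) [NormedAddCommGroup X] [NormedSpace ℝ X] : Type _ :=
  E.bochnerSubmodule X

namespace KotheBochner

variable {Ω : Type*} [MeasurableSpace Ω] {μ : Measure Ω} (E : KotheFunctionSpace μ)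
  (X : Type*) [NormedAddCommGroup X] [NormedSpace ℝ X]

instance instAddCommGroup : AddCommGroup (KotheBochner E X) :=
  inferInstanceAs (AddCommGroup (E.bochnerSubmodule X))

instance instModule : Module ℝ (KotheBochner E X) :=
  inferInstanceAs (Module ℝ (E.bochnerSubmodule X))

/-- The norm of `E(X)` is `‖F‖ = ‖ ‖F(·)‖_X ‖_E`. -/
noncomputable instance instNorm : Norm (KotheBochner E X) :=
  ⟨fun F => E.norm ⟨aeNorm F.1, F.2⟩⟩

theorem core : NormedSpace.Core ℝ (KotheBochner E X) where
  norm_nonneg F := E.norm_nonneg _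
  norm_smul c F := by
    have key : ∀ᵐ ω ∂μ, |aeNorm (c • F.1) ω| = |(c • aeNorm F.1 : Ω →ₘ[μ] ℝ) ω| := by
      filter_upwards [coeFn_aeNorm (c • F.1), coeFn_aeNorm F.1, AEEqFun.coeFn_smul c F.1,
        AEEqFun.coeFn_smul c (aeNorm F.1)] with ω h1 h2 h3 h4
      rw [h1, h3, h4, Pi.smul_apply, Pi.smul_apply, h2, norm_smul]
      simp [abs_mul]
    have h : ‖c • F‖ = E.norm (c • ⟨aeNorm F.1, F.2⟩) :=
      le_antisymm (E.norm_le_of_abs_le _ _ (key.mono fun _ h => h.le))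
        (E.norm_le_of_abs_le _ _ (key.mono fun _ h => h.ge))
    rw [h, E.norm_smul]
    rfl
  norm_triangle F G := by
    refine le_trans (E.norm_le_of_abs_le _ (⟨aeNorm F.1, F.2⟩ + ⟨aeNorm G.1, G.2⟩) ?_)
      (E.norm_add_le _ _)
    change ∀ᵐ ω ∂μ, |aeNorm (F.1 + G.1) ω| ≤ |(aeNorm F.1 + aeNorm G.1 : Ω →ₘ[μ] ℝ) ω|
    filter_upwards [coeFn_aeNorm (F.1 + G.1), coeFn_aeNorm F.1, coeFn_aeNorm G.1,
      AEEqFun.coeFn_add F.1 G.1, AEEqFun.coeFn_add (aeNorm F.1) (aeNorm G.1)] with ω h1 h2 h3 h4 h5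
    rw [h1, h4, h5, Pi.add_apply, Pi.add_apply, h2, h3, abs_of_nonneg (by positivity),
      abs_of_nonneg (by positivity)]
    exact norm_add_le _ _
  norm_eq_zero_iff F := by
    have hF : ‖F‖ = 0 ↔ aeNorm F.1 = 0 := by
      constructor
      · intro h
        exact congrArg Subtype.val (E.eq_zero_of_norm_eq_zero _ h)
      · intro h
        have h0 : (⟨aeNorm F.1, F.2⟩ : E.toSubmodule) = (0 : ℝ) • 0 := by
          apply Subtype.ext
          simpa using h
        change E.norm ⟨aeNorm F.1, F.2⟩ = 0
        rw [h0, E.norm_smul]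
        simp
    rw [hF]
    constructor
    · intro h
      apply Subtype.ext
      apply AEEqFun.ext
      filter_upwards [coeFn_aeNorm F.1, AEEqFun.coeFn_zero (α := Ω) (μ := μ) (β := X),
        AEEqFun.coeFn_zero (α := Ω) (μ := μ) (β := ℝ)] with ω h1 h2 h3
      rw [h, h3, Pi.zero_apply] at h1
      rw [norm_eq_zero.mp h1.symm]
      exact h2.symm
    · rintro rfl
      apply AEEqFun.ext
      filter_upwards [coeFn_aeNorm (0 : Ω →ₘ[μ] X),
        AEEqFun.coeFn_zero (α := Ω) (μ := μ) (β := X),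
        AEEqFun.coeFn_zero (α := Ω) (μ := μ) (β := ℝ)] with ω h1 h2 h3
      change aeNorm (0 : Ω →ₘ[μ] X) ω = _
      rw [h1, h2, h3]
      simp

noncomputable instance instNormedAddCommGroup : NormedAddCommGroup (KotheBochner E X) :=
  NormedAddCommGroup.ofCore (core E X)

noncomputable instance instNormedSpace : NormedSpace ℝ (KotheBochner E X) :=
  NormedSpace.ofCore (core E X)

theorem aeNorm_comp_subtype {X : Type*} [NormedAddCommGroup X] [NormedSpace ℝ X]
    (Y : Submodule ℝ X) (F : Ω →ₘ[μ] Y) :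
    aeNorm (AEEqFun.comp (fun y : Y => (y : X)) continuous_subtype_val F) = aeNorm F := by
  unfold aeNorm
  rw [AEEqFun.comp_comp]
  rfl

/-- The canonical linear isometry `E(Y) → E(X)` for a subspace `Y` of `X`: a `Y`-valued function is
regarded as an `X`-valued one. -/
noncomputable def inclusion {X : Type*} [NormedAddCommGroup X] [NormedSpace ℝ X]
    (Y : Submodule ℝ X) : KotheBochner E Y →ₗᵢ[ℝ] KotheBochner E X where
  toFun F := ⟨AEEqFun.comp (fun y : Y => (y : X)) continuous_subtype_val F.1, by
    change aeNorm _ ∈ E.toSubmodule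
    rw [aeNorm_comp_subtype]
    exact F.2⟩
  map_add' F G := by
    apply Subtype.ext
    apply AEEqFun.ext
    change (AEEqFun.comp (fun y : Y => (y : X)) continuous_subtype_val (F.1 + G.1) : Ω → X) =ᵐ[μ]
      (AEEqFun.comp (fun y : Y => (y : X)) continuous_subtype_val F.1
        + AEEqFun.comp (fun y : Y => (y : X)) continuous_subtype_val G.1 : Ω →ₘ[μ] X)
    filter_upwards [AEEqFun.coeFn_comp (fun y : Y => (y : X)) continuous_subtype_val (F.1 + G.1),
      AEEqFun.coeFn_comp (fun y : Y => (y : X)) continuous_subtype_val F.1,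
      AEEqFun.coeFn_comp (fun y : Y => (y : X)) continuous_subtype_val G.1,
      AEEqFun.coeFn_add F.1 G.1,
      AEEqFun.coeFn_add (AEEqFun.comp (fun y : Y => (y : X)) continuous_subtype_val F.1)
        (AEEqFun.comp (fun y : Y => (y : X)) continuous_subtype_val G.1)] with ω h1 h2 h3 h4 h5
    rw [h1, h5, Pi.add_apply, h2, h3]
    simp [h4]
  map_smul' c F := by
    apply Subtype.ext
    apply AEEqFun.ext
    change (AEEqFun.comp (fun y : Y => (y : X)) continuous_subtype_val (c • F.1) : Ω → X) =ᵐ[μ]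
      (c • AEEqFun.comp (fun y : Y => (y : X)) continuous_subtype_val F.1 : Ω →ₘ[μ] X)
    filter_upwards [AEEqFun.coeFn_comp (fun y : Y => (y : X)) continuous_subtype_val (c • F.1),
      AEEqFun.coeFn_comp (fun y : Y => (y : X)) continuous_subtype_val F.1,
      AEEqFun.coeFn_smul c F.1,
      AEEqFun.coeFn_smul c (AEEqFun.comp (fun y : Y => (y : X)) continuous_subtype_val F.1)]
      with ω h1 h2 h3 h4
    rw [h1, h4, Pi.smul_apply, h2]
    simp [h3]
  norm_map' F := by
    change E.norm ⟨aeNorm (AEEqFun.comp (fun y : Y => (y : X)) continuous_subtype_val F.1), _⟩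
      = E.norm ⟨aeNorm F.1, F.2⟩
    congr 1
    exact Subtype.ext (aeNorm_comp_subtype Y F.1)

/-- `E(Y)` as a subspace of `E(X)`. -/
noncomputable def subspace {X : Type*} [NormedAddCommGroup X] [NormedSpace ℝ X]
    (Y : Submodule ℝ X) : Submodule ℝ (KotheBochner E X) :=
  LinearMap.range (inclusion E Y).toLinearMap

end KotheBochner

/-- A central subspace of a normed space `X`: a closed linear subspace `Y` such that every finite
family of closed balls with centers in `Y` which have a common point in `X` also have a common point
in `Y`. -/
structure IsCentralSubspace {X : Type*} [NormedAddCommGroup X] [NormedSpace ℝ X]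
    (Y : Submodule ℝ X) : Prop where
  isClosed : IsClosed (Y : Set X)
  exists_mem : ∀ (n : ℕ) (y : Fin n → X) (r : Fin n → ℝ), (∀ i, y i ∈ Y) → (∀ i, 0 < r i) →
    (⋂ i, Metric.closedBall (y i) (r i)).Nonempty →
      ((Y : Set X) ∩ ⋂ i, Metric.closedBall (y i) (r i)).Nonempty

/-! Let F lie in the given balls around the G_i. For almost every ω, F(ω) lies in the balls around
G_i(ω) of radius ‖F(ω) - G_i(ω)‖, so centrality puts a point of Y in all of them. If these points
can be chosen to form a measurable H, then solidity of E gives H ∈ E(Y) and ‖H - G_i‖ ≤ ‖F - G_i‖.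

The admissible points depend only on the centres and radii, a parameter in (Y × ℝ)^n, through a
closed relation, and Y is complete and separable. So von Neumann selection
(`exists_measurable_selection_ae`) applies to the pushforward of a finite measure: compact subsets
of Y capture almost all of the projection (`exists_isCompact_le_measure_sectionMeets`), and over a
compact set one takes the leftmost point of a Cantor set parametrization. -/

section Selection

/-! ### Measurable selection for closed relations -/

variable {P Y : Type*}

/-- The points `p` such that the section of `C` over `p` meets `A`. -/
def sectionMeets (C : Set (P × Y)) (A : Set Y) : Set P :=
  {p | ∃ y ∈ A, (p, y) ∈ C}

theorem sectionMeets_iUnion {ι : Sort*} (C : Set (P × Y)) (A : ι → Set Y) :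
    sectionMeets C (⋃ i, A i) = ⋃ i, sectionMeets C (A i) := by
  ext p
  simp only [sectionMeets, Set.mem_iUnion, Set.mem_ofPred_eq]
  exact ⟨fun ⟨y, ⟨i, hi⟩, h⟩ => ⟨i, y, hi, h⟩, fun ⟨i, y, hi, h⟩ => ⟨y, ⟨i, hi⟩, h⟩⟩

theorem sectionMeets_mono (C : Set (P × Y)) {A B : Set Y} (h : A ⊆ B) :
    sectionMeets C A ⊆ sectionMeets C B :=
  fun _ ⟨y, hy, hC⟩ => ⟨y, h hy, hC⟩

theorem isClosed_sectionMeets [TopologicalSpace P] [TopologicalSpace Y] {C : Set (P × Y)}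
    (hC : IsClosed C) {K : Set Y} (hK : IsCompact K) : IsClosed (sectionMeets C K) := by
  have := isCompact_iff_compactSpace.mp hK
  have h : sectionMeets C K = Prod.fst '' ((fun q : P × K => (q.1, (q.2 : Y))) ⁻¹' C) := by
    ext p
    simp [sectionMeets]
  rw [h]
  exact isClosedMap_fst_of_compactSpace _ (hC.preimage (by fun_prop))

/-- Almost all of the projection of a closed set is already the projection of the part of it over a
compact set. -/
theorem exists_isCompact_le_measure_sectionMeets [PseudoMetricSpace P] [MeasurableSpace P]
    [BorelSpace P] [MetricSpace Y] [CompleteSpace Y] [TopologicalSpace.SeparableSpace Y]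
    [Nonempty Y] (ν : Measure P) [IsFiniteMeasure ν] {C : Set (P × Y)} (hC : IsClosed C)
    {c : ENNReal} (hc : c < ν (sectionMeets C Set.univ)) :
    ∃ K : Set Y, IsCompact K ∧ c ≤ ν (sectionMeets C K) := by
  let u := TopologicalSpace.denseSeq Y
  let B : ℕ → ℕ → Set Y := fun m k => ⋃ j ∈ Finset.range k, Metric.closedBall (u j) (1 / (m + 1))
  have hBmono : ∀ m, Monotone (B m) := fun m k l hkl =>
    Set.biUnion_subset_biUnion_left fun j hj =>
      Finset.mem_range.2 ((Finset.mem_range.1 hj).trans_le hkl)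
  have hBclosed : ∀ m k, IsClosed (B m k) := fun m k =>
    isClosed_biUnion_finset fun j _ => Metric.isClosed_closedBall
  have hBuniv : ∀ m, ⋃ k, B m k = Set.univ := by
    intro m
    refine Set.eq_univ_of_forall fun y => ?_
    obtain ⟨j, hj⟩ := (TopologicalSpace.denseRange_denseSeq Y).exists_dist_lt y
      (ε := 1 / ((m : ℝ) + 1)) (by positivity)
    refine Set.mem_iUnion.2 ⟨j + 1, Set.mem_biUnion (x := j) (by simp) ?_⟩
    exact Metric.mem_closedBall.2 hj.le
  have step : ∀ (m : ℕ) (A : Set Y), c < ν (sectionMeets C A) →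
      ∃ k, c < ν (sectionMeets C (A ∩ B m k)) := by
    intro m A hA
    have h1 : sectionMeets C A = ⋃ k, sectionMeets C (A ∩ B m k) := by
      rw [← sectionMeets_iUnion, ← Set.inter_iUnion, hBuniv, Set.inter_univ]
    -- Continuity from below holds for outer measure, so the projections need not be measurable.
    rw [h1, Monotone.measure_iUnion] at hA
    · exact lt_iSup_iff.1 hA
    · exact fun k l hkl => sectionMeets_mono C (Set.inter_subset_inter_right A (hBmono m hkl))
  choose! k hk using step
  let A : ℕ → Set Y := fun m => Nat.rec Set.univ (fun m S => S ∩ B m (k m S)) m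
  have hA : ∀ m, A (m + 1) = A m ∩ B m (k m (A m)) := fun m => rfl
  have hAc : ∀ m, c < ν (sectionMeets C (A m)) := by
    intro m
    induction m with
    | zero => exact hc
    | succ m ih => exact hk m _ ih
  have hAclosed : ∀ m, IsClosed (A m) := by
    intro m
    induction m with
    | zero => exact isClosed_univ
    | succ m ih => exact ih.inter (hBclosed _ _)
  have hAanti : Antitone A := antitone_nat_of_succ_le fun m => Set.inter_subset_left
  -- a sequence with `y m ∈ A m` is totally bounded, and so is the intersection of the `A m`
  have htb : ∀ S : Set Y, (∀ m, (S \ A m).Finite) → TotallyBounded S := by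
    intro S hS
    refine Metric.totallyBounded_iff.2 fun ε hε => ?_
    obtain ⟨m, hm⟩ := exists_nat_one_div_lt hε
    -- The ε-net: the finitely many stray points, and the centres of the balls of radius 1/(m+1) < ε
    -- covering A (m+1).
    refine ⟨(S \ A (m + 1)) ∪ u '' (Finset.range (k m (A m)) : Set ℕ),
      (hS (m + 1)).union ((Finset.finite_toSet (Finset.range (k m (A m)))).image u), fun y hy => ?_⟩
    rcases Classical.em (y ∈ A (m + 1)) with hyA | hyA
    · rw [hA] at hyA
      obtain ⟨j, hj, hyj⟩ := Set.mem_iUnion₂.1 hyA.2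
      exact Set.mem_biUnion (x := u j) (Or.inr ⟨j, hj, rfl⟩)
        (Metric.mem_ball.2 ((Metric.mem_closedBall.1 hyj).trans_lt hm))
    · exact Set.mem_biUnion (x := y) (Or.inl ⟨hy, hyA⟩) (Metric.mem_ball_self hε)
  refine ⟨⋂ m, A m, (htb _ fun m => ?_).isCompact_of_isClosed (isClosed_iInter hAclosed), ?_⟩
  · rw [Set.sdiff_eq_empty.2 (Set.iInter_subset A m)]
    exact Set.finite_empty
  -- Closures make the projections measurable, as continuity from above requires; total boundedness
  -- shows that nothing is gained in the limit.
  have hsub : ⋂ m, closure (sectionMeets C (A m)) ⊆ sectionMeets C (⋂ m, A m) := by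
    intro p hp
    have h1 : ∀ m : ℕ, ∃ q : P × Y, q ∈ C ∧ q.2 ∈ A m ∧ dist p q.1 < 1 / ((m : ℝ) + 1) := by
      intro m
      obtain ⟨q, ⟨y, hy, hq⟩, hd⟩ := Metric.mem_closure_iff.1 (Set.mem_iInter.1 hp m)
        (1 / ((m : ℝ) + 1)) (by positivity)
      exact ⟨(q, y), hq, hy, hd⟩
    choose q hqC hqA hqd using h1
    have hqt : Tendsto (fun m => (q m).1) atTop (𝓝 p) := by
      rw [tendsto_iff_dist_tendsto_zero]
      refine squeeze_zero (fun _ => dist_nonneg) (fun m => ?_)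
        tendsto_one_div_add_atTop_nhds_zero_nat
      rw [dist_comm]
      exact (hqd m).le
    have hcomp : IsCompact (closure (Set.range fun m => (q m).2)) := by
      refine (htb _ fun m => ?_).closure.isCompact_of_isClosed isClosed_closure
      refine ((Set.finite_Iio m).image fun j => (q j).2).subset ?_
      rintro _ ⟨⟨j, rfl⟩, hj⟩
      refine ⟨j, ?_, rfl⟩
      by_contra hjm
      exact hj (hAanti (not_lt.1 hjm) (hqA j))
    obtain ⟨y, -, φ, hφ, hy⟩ := hcomp.tendsto_subseq fun m => subset_closure ⟨m, rfl⟩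
    refine ⟨y, Set.mem_iInter.2 fun m => ?_, ?_⟩
    · refine (hAclosed m).mem_of_tendsto hy ?_
      filter_upwards [eventually_ge_atTop m] with j hj
      exact hAanti (hj.trans hφ.le_apply) (hqA _)
    · exact hC.mem_of_tendsto ((hqt.comp hφ.tendsto_atTop).prodMk_nhds hy)
        (Eventually.of_forall fun j => hqC _)
  refine le_trans ?_ (measure_mono hsub)
  rw [Antitone.measure_iInter
    (fun i j hij => closure_mono (sectionMeets_mono C (hAanti hij)))
    (fun m => isClosed_closure.nullMeasurableSet) ⟨0, measure_ne_top _ _⟩]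
  exact le_iInf fun m => (hAc m).le.trans (measure_mono subset_closure)

/-- A closed relation has a measurable selection over a compact set. -/
theorem exists_measurable_selection_of_isCompact [TopologicalSpace P] [MeasurableSpace P]
    [BorelSpace P] [MetricSpace Y] [MeasurableSpace Y] [BorelSpace Y] [Nonempty Y]
    {C : Set (P × Y)} (hC : IsClosed C) {K : Set Y} (hK : IsCompact K) :
    ∃ s : P → Y, Measurable s ∧ ∀ p ∈ sectionMeets C K, (p, s p) ∈ C := by
  rcases K.eq_empty_or_nonempty with rfl | hne
  · inhabit Y
    exact ⟨fun _ => default, measurable_const, fun p ⟨y, hy, _⟩ => hy.elim⟩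
  have := hne.to_subtype
  have := isCompact_iff_compactSpace.mp hK
  obtain ⟨f, hf, hfs⟩ := exists_nat_bool_continuous_surjective_of_compact K
  let g : cantorSet → Y := fun t => f (cantorSetHomeomorphNatToBool t)
  have hg : Continuous g := by fun_prop
  let D : Set (P × ℝ) := (fun q : P × cantorSet => (q.1, (q.2 : ℝ))) ''
    ((fun q : P × cantorSet => (q.1, g q.2)) ⁻¹' C)
  have hemb : IsClosedEmbedding (fun q : P × cantorSet => (q.1, (q.2 : ℝ))) :=
    IsClosedEmbedding.id.prodMap isClosed_cantorSet.isClosedEmbedding_subtypeVal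
  have hD : IsClosed D := hemb.isClosedMap _ (hC.preimage (by fun_prop))
  have hDmem : ∀ {p : P} {t : ℝ}, (p, t) ∈ D ↔ ∃ h : t ∈ cantorSet, (p, g ⟨t, h⟩) ∈ C := by
    intro p t
    simp [D]
  -- Sections of D are compact, so the infimum is attained whenever the section is nonempty.
  let T : P → ℝ := fun p => sInf {t | (p, t) ∈ D}
  have hbdd : ∀ p, BddBelow {t | (p, t) ∈ D} := fun p =>
    ⟨0, fun t ht => (cantorSet_subset_unitInterval (hDmem.1 ht).1).1⟩
  have hmin : ∀ p, {t | (p, t) ∈ D}.Nonempty → (p, T p) ∈ D := fun p hp =>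
    (hD.preimage (Continuous.prodMk_right p)).csInf_mem hp (hbdd p)
  have hdom : ∀ S : Set ℝ, ∀ p, p ∈ sectionMeets D (cantorSet ∩ S) ↔ ∃ t ∈ S, (p, t) ∈ D :=
    fun S p => ⟨fun ⟨t, ht, h⟩ => ⟨t, ht.2, h⟩, fun ⟨t, ht, h⟩ => ⟨t, ⟨(hDmem.1 h).1, ht⟩, h⟩⟩
  have hclosed : ∀ S : Set ℝ, IsClosed S → IsClosed (sectionMeets D (cantorSet ∩ S)) :=
    fun S hS => isClosed_sectionMeets hD (isCompact_cantorSet.inter_right hS)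
  have hT : Measurable T := by
    refine measurable_of_Iic fun a => ?_
    -- The second piece accounts for empty sections, where T p = sInf ∅ = 0.
    have h : T ⁻¹' Set.Iic a = sectionMeets D (cantorSet ∩ Set.Iic a) ∪
        ((sectionMeets D (cantorSet ∩ Set.univ))ᶜ ∩ {_p | 0 ≤ a}) := by
      ext p
      rw [Set.mem_union, Set.mem_inter_iff, Set.mem_compl_iff, hdom, hdom, Set.mem_preimage,
        Set.mem_Iic]
      by_cases hp : {t | (p, t) ∈ D}.Nonempty
      · have h1 : ∃ t ∈ (Set.univ : Set ℝ), (p, t) ∈ D := hp.imp fun t ht => ⟨trivial, ht⟩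
        simp only [h1, not_true_eq_false, false_and, or_false]
        exact ⟨fun h => ⟨T p, h, hmin p hp⟩, fun ⟨t, ht, h⟩ => (csInf_le (hbdd p) h).trans ht⟩
      · have h2 : ∀ t, (p, t) ∉ D := fun t ht => hp ⟨t, ht⟩
        have h3 : T p = 0 := by
          simp only [T, h2]
          exact Real.sInf_empty
        simp [h2, h3]
    rw [h]
    exact (hclosed _ isClosed_Iic).measurableSet.union
      ((hclosed _ isClosed_univ).measurableSet.compl.inter (MeasurableSet.const _))
  let t₀ : cantorSet := ⟨0, zero_mem_cantorSet⟩
  classical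
  let r : ℝ → cantorSet := fun t => if h : t ∈ cantorSet then ⟨t, h⟩ else t₀
  have hr : Measurable r :=
    Measurable.dite measurable_id measurable_const isClosed_cantorSet.measurableSet
  refine ⟨fun p => g (r (T p)), hg.measurable.comp (hr.comp hT), ?_⟩
  rintro p ⟨y, hy, hpy⟩
  obtain ⟨b, hb⟩ := hfs ⟨y, hy⟩
  have hne' : {t | (p, t) ∈ D}.Nonempty := by
    refine ⟨(cantorSetHomeomorphNatToBool.symm b : cantorSet), hDmem.2 ⟨Subtype.property _, ?_⟩⟩
    simpa [g, hb] using hpy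
  obtain ⟨h, h'⟩ := hDmem.1 (hmin p hne')
  simpa [r, h] using h'

/-- **Von Neumann's selection theorem** for closed relations: if the projection of the closed set
`C` has full outer measure, then `C` contains the graph of a measurable function defined almost
everywhere. -/
theorem exists_measurable_selection_ae [PseudoMetricSpace P] [MeasurableSpace P]
    [BorelSpace P] [MetricSpace Y] [CompleteSpace Y] [TopologicalSpace.SeparableSpace Y]
    [MeasurableSpace Y] [BorelSpace Y] [Nonempty Y] (ν : Measure P) [IsFiniteMeasure ν]
    {C : Set (P × Y)} (hC : IsClosed C)
    (hfull : ν (sectionMeets C Set.univ) = ν Set.univ) :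
    ∃ s : P → Y, Measurable s ∧ ∀ᵐ p ∂ν, (p, s p) ∈ C := by
  rcases eq_or_ne (ν Set.univ) 0 with h0 | h0
  · inhabit Y
    refine ⟨fun _ => default, measurable_const, ?_⟩
    rw [Measure.measure_univ_eq_zero.1 h0]
    simp
  obtain ⟨c, -, hc, hctend⟩ := exists_seq_strictMono_tendsto' (pos_iff_ne_zero.2 h0)
  have hK : ∀ n, ∃ K : Set Y, IsCompact K ∧ c n ≤ ν (sectionMeets C K) := fun n =>
    exists_isCompact_le_measure_sectionMeets ν hC (by rw [hfull]; exact (hc n).2)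
  choose K hKc hKle using hK
  have hKm : ∀ n, MeasurableSet (sectionMeets C (K n)) := fun n =>
    (isClosed_sectionMeets hC (hKc n)).measurableSet
  have hall : ∀ᵐ p ∂ν, ∃ n, p ∈ sectionMeets C (K n) := by
    have h1 : ν (⋃ n, sectionMeets C (K n)) = ν Set.univ :=
      le_antisymm (measure_mono (Set.subset_univ _)) (le_of_tendsto' hctend fun n =>
        (hKle n).trans (measure_mono (Set.subset_iUnion (fun n => sectionMeets C (K n)) n)))
    have h2 := measure_compl (MeasurableSet.iUnion hKm) (measure_ne_top ν _)
    rw [h1, tsub_self] at h2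
    filter_upwards [measure_eq_zero_iff_ae_notMem.1 h2] with p hp
    simpa using hp
  choose s hs hsC using fun n => exists_measurable_selection_of_isCompact hC (hKc n)
  -- The selections may disagree on overlaps, so they are glued along disjoint pieces.
  obtain ⟨f, hf, hfs⟩ := exists_measurable_piecewise
    (disjointed fun n => sectionMeets C (K n)) (MeasurableSet.disjointed hKm) s hs
    (fun i j hij => by
      dsimp only
      rw [((disjoint_disjointed _) hij).inter_eq]
      exact Set.eqOn_empty _ _)
  refine ⟨f, hf, ?_⟩
  filter_upwards [hall] with p hp
  have hp' : p ∈ ⋃ n, disjointed (fun n => sectionMeets C (K n)) n := by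
    rw [iUnion_disjointed]
    exact Set.mem_iUnion.2 hp
  obtain ⟨n, hn⟩ := Set.mem_iUnion.1 hp'
  rw [hfs n hn]
  exact hsC n p (disjointed_subset _ n hn)

end Selection

/-! ### `E(Y)` inside `E(X)` -/

namespace KotheBochner

variable {Ω : Type*} [MeasurableSpace Ω] {μ : Measure Ω} {E : KotheFunctionSpace μ}
  {X : Type*} [NormedAddCommGroup X] [NormedSpace ℝ X]

theorem norm_le_norm_of_ae {X' : Type*} [NormedAddCommGroup X'] [NormedSpace ℝ X']
    {F : KotheBochner E X} {G : KotheBochner E X'} (h : ∀ᵐ ω ∂μ, ‖F.1 ω‖ ≤ ‖G.1 ω‖) :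
    ‖F‖ ≤ ‖G‖ := by
  refine E.norm_le_of_abs_le _ _ ?_
  filter_upwards [h, coeFn_aeNorm F.1, coeFn_aeNorm G.1] with ω h h1 h2
  rw [h1, h2, abs_norm, abs_norm]
  exact h

theorem coeFn_sub (F G : KotheBochner E X) : ∀ᵐ ω ∂μ, (F - G).1 ω = F.1 ω - G.1 ω :=
  AEEqFun.coeFn_sub F.1 G.1

theorem coeFn_inclusion (Y : Submodule ℝ X) (G : KotheBochner E Y) :
    ∀ᵐ ω ∂μ, (inclusion E Y G).1 ω = G.1 ω :=
  AEEqFun.coeFn_comp (fun y : Y => (y : X)) continuous_subtype_val G.1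

/-- The elements of `E(Y)` are the elements of `E(X)` with values in `Y`. -/
theorem mem_subspace_iff (Y : Submodule ℝ X) [TopologicalSpace.SeparableSpace Y]
    {F : KotheBochner E X} : F ∈ subspace E Y ↔ ∀ᵐ ω ∂μ, F.1 ω ∈ Y := by
  constructor
  · rintro ⟨G, rfl⟩
    filter_upwards [coeFn_inclusion Y G] with ω h
    exact h ▸ (G.1 ω).2
  · intro hF
    borelize X
    have := UniformSpace.secondCountable_of_separable Y
    obtain ⟨g, hg, hgY, hFg⟩ := F.1.measurable.aemeasurable.exists_ae_eq_range_subset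
      (t := (Y : Set X)) hF ⟨0, Y.zero_mem⟩
    let g' : Ω → Y := fun ω => ⟨g ω, hgY ⟨ω, rfl⟩⟩
    have hg' : AEStronglyMeasurable g' μ :=
      (Measurable.subtype_mk hg).stronglyMeasurable.aestronglyMeasurable
    have heq : AEEqFun.comp (fun y : Y => (y : X)) continuous_subtype_val (AEEqFun.mk g' hg')
        = F.1 := by
      apply AEEqFun.ext
      filter_upwards [AEEqFun.coeFn_comp (fun y : Y => (y : X)) continuous_subtype_val
        (AEEqFun.mk g' hg'), AEEqFun.coeFn_mk g' hg', hFg] with ω h1 h2 h3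
      rw [h1, Function.comp_apply, h2, h3]
    refine ⟨⟨AEEqFun.mk g' hg', ?_⟩, Subtype.ext heq⟩
    change aeNorm _ ∈ E.toSubmodule
    rw [← aeNorm_comp_subtype, heq]
    exact F.2

/-- The function d(ω) = dist(F(ω), Y) is dominated by ‖F(ω) - G(ω)‖ for every G in E(Y). Hence ‖d‖_E
= 0 when F is in the closure, and F(ω) ∈ Y a.e. since Y is closed. -/
theorem isClosed_subspace {Y : Submodule ℝ X} [TopologicalSpace.SeparableSpace Y]
    (hY : IsClosed (Y : Set X)) : IsClosed (subspace E Y : Set (KotheBochner E X)) := by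
  refine isClosed_of_closure_subset fun F hF => (mem_subspace_iff Y).2 ?_
  have hYne : (Y : Set X).Nonempty := ⟨0, Y.zero_mem⟩
  let d : Ω →ₘ[μ] ℝ := AEEqFun.comp (fun x => Metric.infDist x (Y : Set X))
    (Metric.continuous_infDist_pt _) F.1
  have hd : ∀ᵐ ω ∂μ, d ω = Metric.infDist (F.1 ω) (Y : Set X) := AEEqFun.coeFn_comp _ _ _
  have hle : ∀ G ∈ subspace E Y, ∀ᵐ ω ∂μ, |d ω| ≤ |aeNorm (F - G).1 ω| := by
    intro G hG
    filter_upwards [hd, coeFn_aeNorm (F - G).1, coeFn_sub F G, (mem_subspace_iff Y).1 hG]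
      with ω h1 h2 h3 h4
    rw [h1, h2, h3, abs_norm, abs_of_nonneg Metric.infDist_nonneg, ← dist_eq_norm]
    exact Metric.infDist_le_dist_of_mem h4
  have hdE : d ∈ E.toSubmodule :=
    E.mem_of_abs_le _ _ (F - 0).2 (hle 0 (subspace E Y).zero_mem)
  have hd0 : E.norm ⟨d, hdE⟩ = 0 := by
    refine le_antisymm (le_of_forall_pos_le_add fun ε hε => ?_) (E.norm_nonneg _)
    obtain ⟨G, hG, hFG⟩ := Metric.mem_closure_iff.1 hF ε hε
    rw [dist_eq_norm] at hFG
    rw [zero_add]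
    exact (E.norm_le_of_abs_le _ ⟨_, (F - G).2⟩ (hle G hG)).trans hFG.le
  have hzero : d = 0 := congrArg Subtype.val (E.eq_zero_of_norm_eq_zero _ hd0)
  filter_upwards [hd, AEEqFun.coeFn_zero (α := Ω) (μ := μ) (β := ℝ)] with ω h1 h2
  rw [hzero, h2] at h1
  exact (hY.mem_iff_infDist_zero hYne).2 h1.symm

end KotheBochner

/-! ### Centrality, pointwise and in `E(X)` -/

theorem IsCentralSubspace.exists_dist_le {X : Type*} [NormedAddCommGroup X] [NormedSpace ℝ X]
    {Y : Submodule ℝ X} (hY : IsCentralSubspace Y) {n : ℕ} (x : X) (y : Fin n → Y) :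
    ∃ z : Y, ∀ i, dist z (y i) ≤ ‖x - y i‖ := by
  -- Centrality needs positive radii; if one vanishes, x is itself a centre and serves as z.
  by_cases hx : ∃ i, x = y i
  · obtain ⟨i, rfl⟩ := hx
    exact ⟨y i, fun j => (dist_eq_norm (y i : X) (y j)).le⟩
  · have hne : ∀ i, 0 < ‖x - y i‖ := fun i => norm_pos_iff.2 (sub_ne_zero.2 fun h => hx ⟨i, h⟩)
    obtain ⟨z, hzY, hz⟩ := hY.exists_mem n (fun i => y i) (fun i => ‖x - y i‖)
      (fun i => (y i).2) hne
      ⟨x, Set.mem_iInter.2 fun i => Metric.mem_closedBall.2 (dist_eq_norm _ _).le⟩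
    exact ⟨⟨z, hzY⟩, fun i => Metric.mem_closedBall.1 (Set.mem_iInter.1 hz i)⟩

/-- The points of `Y` provided by centrality can be chosen measurably. -/
theorem IsCentralSubspace.exists_measurable_norm_sub_le {Ω : Type*} [MeasurableSpace Ω]
    (μ : Measure Ω) [SFinite μ] {X : Type*} [NormedAddCommGroup X] [NormedSpace ℝ X]
    [CompleteSpace X] {Y : Submodule ℝ X} [TopologicalSpace.SeparableSpace Y]
    (hY : IsCentralSubspace Y) {n : ℕ} (F : Ω →ₘ[μ] X) (g : Fin n → Ω →ₘ[μ] Y) :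
    ∃ H : Ω →ₘ[μ] Y, ∀ i, ∀ᵐ ω ∂μ, ‖H ω - g i ω‖ ≤ ‖F ω - g i ω‖ := by
  borelize X
  have := UniformSpace.secondCountable_of_separable Y
  have : CompleteSpace Y := hY.isClosed.completeSpace_coe
  let d : Fin n → Ω →ₘ[μ] ℝ := fun i =>
    aeNorm (F - AEEqFun.comp (fun y : Y => (y : X)) continuous_subtype_val (g i))
  have hd : ∀ᵐ ω ∂μ, ∀ i, d i ω = ‖F ω - g i ω‖ := by
    refine ae_all_iff.2 fun i => ?_
    filter_upwards [coeFn_aeNorm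
        (F - AEEqFun.comp (fun y : Y => (y : X)) continuous_subtype_val (g i)),
      AEEqFun.coeFn_sub F (AEEqFun.comp (fun y : Y => (y : X)) continuous_subtype_val (g i)),
      AEEqFun.coeFn_comp (fun y : Y => (y : X)) continuous_subtype_val (g i)] with ω h1 h2 h3
    rw [h1, h2, Pi.sub_apply, h3, Function.comp_apply]
  let φ : Ω → Fin n → Y × ℝ := fun ω i => (g i ω, d i ω)
  have hφ : Measurable φ := measurable_pi_lambda _ fun i => (g i).measurable.prodMk (d i).measurable
  let C : Set ((Fin n → Y × ℝ) × Y) := {q | ∀ i, dist q.2 (q.1 i).1 ≤ (q.1 i).2}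
  have hC : IsClosed C := by
    simp only [C, Set.ofPred_forall]
    exact isClosed_iInter fun i => isClosed_le (by fun_prop) (by fun_prop)
  have hsec : ∀ᵐ ω ∂μ, φ ω ∈ sectionMeets C Set.univ := by
    filter_upwards [hd] with ω hω
    obtain ⟨z, hz⟩ := hY.exists_dist_le (F ω) fun i => g i ω
    exact ⟨z, trivial, fun i => (hz i).trans_eq (hω i).symm⟩
  -- `μ.toFinite` is finite with the null sets of μ. The projection may be non-measurable, but its
  -- pushforward measure still bounds that of its preimage from above.
  have hfull : μ.toFinite.map φ (sectionMeets C Set.univ) = μ.toFinite.map φ Set.univ := by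
    refine le_antisymm (measure_mono (Set.subset_univ _)) ?_
    refine le_trans ?_ (Measure.le_map_apply hφ.aemeasurable _)
    rw [Measure.map_apply hφ MeasurableSet.univ]
    refine measure_mono_ae ?_
    rw [ae_toFinite]
    filter_upwards [hsec] with ω hω _ using hω
  obtain ⟨s, hs, hsC⟩ := exists_measurable_selection_ae (μ.toFinite.map φ) hC hfull
  have hae := ae_of_ae_map hφ.aemeasurable hsC
  rw [ae_toFinite] at hae
  have hmeas : AEStronglyMeasurable (s ∘ φ) μ :=
    (hs.comp hφ).stronglyMeasurable.aestronglyMeasurable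
  refine ⟨AEEqFun.mk _ hmeas, fun i => ?_⟩
  filter_upwards [hae, hd, AEEqFun.coeFn_mk _ hmeas] with ω h1 h2 h3
  rw [h3, ← h2 i, ← dist_eq_norm]
  exact h1 i

theorem theorem2p9 {Ω : Type*} [MeasurableSpace Ω] (μ : Measure Ω) [SigmaFinite μ]
    (E : KotheFunctionSpace μ) (hE : E.IsOrderContinuous)
    {X : Type*} [NormedAddCommGroup X] [NormedSpace ℝ X] [CompleteSpace X]
    (Y : Submodule ℝ X) (hsep : TopologicalSpace.SeparableSpace Y) (hY : IsCentralSubspace Y) :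
    IsCentralSubspace (KotheBochner.subspace E Y) := by
  refine ⟨KotheBochner.isClosed_subspace hY.isClosed, fun n G r hG _ ⟨F, hF⟩ => ?_⟩
  choose g hg using hG
  have hFle : ∀ i, ‖F - G i‖ ≤ r i := fun i => by
    rw [← dist_eq_norm]
    exact Metric.mem_closedBall.1 (Set.mem_iInter.1 hF i)
  obtain ⟨H, hH⟩ := hY.exists_measurable_norm_sub_le μ F.1 fun i => (g i).1
  have hle : ∀ i, ∀ᵐ ω ∂μ, ‖H ω - (g i).1 ω‖ ≤ ‖(F - G i).1 ω‖ := fun i => by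
    filter_upwards [hH i, KotheBochner.coeFn_sub F (G i), KotheBochner.coeFn_inclusion Y (g i)]
      with ω h1 h2 h3
    rw [h2, ← hg i]
    exact h1.trans_eq (by rw [← h3]; rfl)
  -- Without a centre to compare with, H need not lie in E(Y); the intersection is then everything
  -- and 0 works.
  rcases n.eq_zero_or_pos with rfl | hn
  · exact ⟨0, (KotheBochner.subspace E Y).zero_mem, Set.mem_iInter.2 fun i => i.elim0⟩
  have hHE : H ∈ E.bochnerSubmodule Y := by
    let i : Fin n := ⟨0, hn⟩
    refine E.mem_of_abs_le _ (aeNorm (F - G i).1 + aeNorm (g i).1)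
      (E.toSubmodule.add_mem (F - G i).2 (g i).2) ?_
    filter_upwards [hle i, coeFn_aeNorm H, coeFn_aeNorm (F - G i).1, coeFn_aeNorm (g i).1,
      AEEqFun.coeFn_add (aeNorm (F - G i).1) (aeNorm (g i).1)] with ω h1 h2 h3 h4 h5
    rw [h2, h5, Pi.add_apply, h3, h4, abs_norm, abs_of_nonneg (by positivity)]
    calc ‖H ω‖ = ‖(H ω - (g i).1 ω) + (g i).1 ω‖ := by rw [sub_add_cancel]
      _ ≤ ‖H ω - (g i).1 ω‖ + ‖(g i).1 ω‖ := norm_add_le _ _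
      _ ≤ _ := by gcongr
  let H' : KotheBochner E Y := ⟨H, hHE⟩
  refine ⟨KotheBochner.inclusion E Y H', ⟨H', rfl⟩, Set.mem_iInter.2 fun i => ?_⟩
  rw [Metric.mem_closedBall, ← hg i]
  change dist (KotheBochner.inclusion E Y H') (KotheBochner.inclusion E Y (g i)) ≤ r i
  rw [LinearIsometry.dist_map, dist_eq_norm]
  refine le_trans (KotheBochner.norm_le_norm_of_ae ?_) (hFle i)
  filter_upwards [hle i, KotheBochner.coeFn_sub H' (g i)] with ω h1 h2
  rw [h2]
  exact h1
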